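/- \textbf{Setting.} Let $d\ge 1$ and let $S\subset\mathbb R^d$ be measurable with $0<\mathrm{vol}(S)<\infty$ (the sampling region). Let $X_1,X_2,\dots$ be independent and uniformly distributed on $S$. A configuration space $\mathcal X\subset\mathbb R^d$, a goal $x_{\mathrm{goal}}$ and a finite set $Q$ of prescribed robot configurations (the start configuration among them) are fixed; put $V_n=\{x_{\mathrm{goal}}\}\cup Q\cup\{X_1,\dots,X_n\}$, $r_n=\gamma(\log n/n)^{1/d}$ and $\mathrm{Near}(z)=\{x\in V_n\setminus\{z\}:\|x-z\|\le r_n\}$. A \emph{phase} consists of a finite set $O$ of obstacles (subsets of $\mathbb R^d$) and a robot vertex; its free space is $\mathcal X\setminus\bigcup O$. An edge is the straight segment between two vertices at distance at most $r_n$; it is blocked by $o$ if it meets $o$, and collision-free if it lies in the free space. \textbf{FMT$^X$.} The planner keeps costs $c(x)\in[0,\infty]$, parent pointers and an open set $V_{\mathrm{open}}$. Initially $c(x_{\mathrm{goal}})=0$, $c=\infty$ elsewhere, there are no parents, and $V_{\mathrm{open}}=\{x_{\mathrm{goal}}\}$. For a set $U$ of vertices, $\mathtt{QueueNeighbors}(U)$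 makes every neighbour $y$ of a vertex of $U$ with $c(y)<\infty$ open. In each phase the planner does the following. (1) For every newly appeared obstacle $o$, let $V^-$ be the set of the vertices whose parent edge is blocked by $o$ and of all their descendants; these lose their parent, get cost $\infty$ and leave $V_{\mathrm{open}}$, and $\mathtt{QueueNeighbors}(V^-)$ is run. (2) For every vanished obstacle $o$, which is first deleted from the obstacle set, let $V^+$ be the set of the endpoints of the edges that were blocked by $o$ and are blocked by no remaining obstacle; $\mathtt{QueueNeighbors}(V^+)$ is run. (3) While $V_{\mathrm{open}}\ne\emptyset$ and ($\min_{V_{\mathrm{open}}}c<c(v_{\mathrm{robot}})$ or $v_{\mathrm{robot}}\in V_{\mathrm{open}}$): extract a vertex $z$ of least cost; for each $x\in\mathrm{Near}(z)$ with $c(x)>c(z)+\|z-x\|$ choose $y$ minimising $c(y)+\|y-x\|$ over $\mathrm{Near}(x)\cap(V_{\mathrm{open}}\cup\{z\})$ and, if the edge $yx$ is collision-free, set $c(x)=c(y)+\|y-x\|$, make $y$ the parent of $x$ and make $x$ open. All ties and processing orders are arbitrary. The planner has converged for a phase when this loop has stopped; the cost of its path to the robot is then $c(v_{\mathrm{robot}})$.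 \textbf{Statement.} There is $\gamma_0>0$, depending only on $d$ and $S$, such that the following holds for every $\gamma\ge\gamma_0$. Fix a phase $k$, with free space $\mathcal X^k_{\mathrm{free}}\subset S$ and robot vertex $x^k_{\mathrm{bot}}\in Q$, and let $c_k^*\in[0,\infty]$ be the infimum of the lengths of the continuous paths in $\mathcal X^k_{\mathrm{free}}$ from $x^k_{\mathrm{bot}}$ to $x_{\mathrm{goal}}$. Assume that $c_k^*$ is also the infimum over those of these paths that have positive clearance (a path has positive clearance if, for some $\delta>0$, the $\delta$-ball around each of its points lies in $\mathcal X^k_{\mathrm{free}}$); this is automatic when $\mathcal X^k_{\mathrm{free}}$ is open. Then: (i) for every $n$, all values of the samples and every finite history of earlier phases with robot vertices in $V_n$, FMT$^X$ has an execution that converges in each of these phases and in phase $k$; (ii) for every $\varepsilon>0$, with $c_{\mathrm{FMT}^X,n}=c(x^k_{\mathrm{bot}})$ denoting the cost of the path to the robot after convergence in phase $k$, $$\Pr\bigl(c_{\mathrm{FMT}^X,n}>(1+\varepsilon)\,c_k^*\bigr)\to0\qquad(n\to\infty).$$ Here the event is that the inequality holds for at least one history of earlier phases (with robot vertices in $V_n$,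 possibly depending on $n$ and on the samples) and at least one converged execution, and $\Pr$ is the outer probability. So FMT$^X$ is asymptotically optimal, in the sense of convergence in probability, on every static segment. -/

import Mathlib

open MeasureTheory ProbabilityTheory Filter Topology
open scoped ENNReal

namespace FMTX

/-- The ambient space `ℝ^d` with its Euclidean norm. -/
abbrev E (d : ℕ) : Type := EuclideanSpace ℝ (Fin d)

variable {d : ℕ}

/-! ### Continuous problem -/

/-- The free space of a configuration space `X` with finitely many obstacles `O`. -/
def freeSpace (X : Set (E d)) (O : Finset (Set (E d))) : Set (E d) :=
  X \ ⋃ o ∈ O, o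

/-- Arc length of a continuous path (`∞` if it is not rectifiable). -/
noncomputable def pathLength {a b : E d} (σ : Path a b) : ℝ≥0∞ :=
  eVariationOn (fun t => σ t) Set.univ

/-- Optimal cost from `a` to `b` inside `F`: infimum of the lengths of the continuous paths
in `F` (`∞` if there are none). -/
noncomputable def optimalCost (F : Set (E d)) (a b : E d) : ℝ≥0∞ :=
  ⨅ (σ : Path a b) (_ : ∀ t, σ t ∈ F), pathLength σ

/-- The path keeps distance at least `δ` from everything outside `F`. -/
def HasClearance (F : Set (E d)) {a b : E d} (σ : Path a b) (δ : ℝ) : Prop :=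
  ∀ t, Metric.ball (σ t) δ ⊆ F

/-- The optimal cost in `F` is approached by paths of positive clearance. This holds for every
open `F` (the trace of a path is compact), and trivially if no path exists at all. -/
def RobustlyOptimal (F : Set (E d)) (a b : E d) : Prop :=
  ∀ L : ℝ≥0∞, optimalCost F a b < L →
    ∃ σ : Path a b, (∃ δ : ℝ, 0 < δ ∧ HasClearance F σ δ) ∧ pathLength σ < L

/-! ### Samples, disk graph, collision tests -/

/-- Connection radius `γ (log n / n)^(1/d)`. -/
noncomputable def radius (d : ℕ) (γ : ℝ) (n : ℕ) : ℝ :=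
  γ * (Real.log n / n) ^ (1 / (d : ℝ))

/-- Vertex set: the goal, the prescribed robot configurations `Q` and the first `n` samples. -/
def vertices (goal : E d) (Q : Set (E d)) (ξ : ℕ → E d) (n : ℕ) : Set (E d) :=
  insert goal (Q ∪ ξ '' Set.Iio n)

/-- Neighbours of `z` in the `r`-disk graph on `V`. -/
def near (V : Set (E d)) (r : ℝ) (z : E d) : Set (E d) :=
  {x | x ∈ V ∧ x ≠ z ∧ dist x z ≤ r}

/-- The straight edge between `x` and `y` meets the obstacle `o`. -/
def EdgeBlocked (x y : E d) (o : Set (E d)) : Prop :=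
  (segment ℝ x y ∩ o).Nonempty

/-- The straight edge between `y` and `x` stays in the free space. -/
def CollisionFree (X : Set (E d)) (O : Finset (Set (E d))) (y x : E d) : Prop :=
  segment ℝ y x ⊆ freeSpace X O

/-! ### The state of the planner and the treatment of obstacle changes -/

/-- State of the planner: cost-to-come, parent pointers (the tree) and the open set.
The edge cost `Cost(x, y)` is the Euclidean distance, written `edist x y`. -/
structure State (d : ℕ) where
  cost : E d → ℝ≥0∞
  parent : E d → Option (E d)
  opens : Set (E d)

open Classical in
/-- Initial state: only the goal is reached, and it is open. -/
noncomputable def initState (goal : E d) : State d where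
  cost := fun x => if x = goal then 0 else ∞
  parent := fun _ => none
  opens := {goal}

/-- `QueueNeighbors(U)`. -/
def queueNeighbors (V : Set (E d)) (r : ℝ) (U : Set (E d)) (s : State d) : State d :=
  { s with opens := s.opens ∪ {y | s.cost y < ∞ ∧ ∃ u ∈ U, y ∈ near V r u} }

/-- The vertices whose parent edge is blocked by `o`, together with all their descendants. -/
def orphans (V : Set (E d)) (o : Set (E d)) (s : State d) : Set (E d) :=
  {x | ∃ w ∈ V, (∃ y, s.parent w = some y ∧ EdgeBlocked w y o) ∧
    Relation.ReflTransGen (fun p q => s.parent q = some p) w x}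

open Classical in
/-- Remove the vertices in `U` from the tree and from the open set. -/
noncomputable def prune (U : Set (E d)) (s : State d) : State d where
  cost := fun x => if x ∈ U then ∞ else s.cost x
  parent := fun x => if x ∈ U then none else s.parent x
  opens := s.opens \ U

/-- One pass of the loop of `AddObstacles`. -/
noncomputable def addObstacle (V : Set (E d)) (r : ℝ) (o : Set (E d)) (s : State d) : State d :=
  queueNeighbors V r (orphans V o s) (prune (orphans V o s) s)

/-- Endpoints of the disk-graph edges which were blocked by `o` and by none of the obstacles `O`
that remain. -/
def restored (V : Set (E d)) (r : ℝ) (O : Finset (Set (E d))) (o : Set (E d)) : Set (E d) :=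
  {x | x ∈ V ∧ ∃ y ∈ near V r x, EdgeBlocked x y o ∧ ∀ o' ∈ O, ¬ EdgeBlocked x y o'}

/-- `AddObstacles`, the obstacles being processed in the order of the list. -/
noncomputable def addObstacles (V : Set (E d)) (r : ℝ) (l : List (Set (E d))) (s : State d) :
    State d :=
  l.foldl (fun s o => addObstacle V r o s) s

open Classical in
/-- `RemoveObstacles`, the obstacles being processed in the order of the list; `O` is the set of
obstacles present before. -/
noncomputable def removeObstacles (V : Set (E d)) (r : ℝ) :
    Finset (Set (E d)) → List (Set (E d)) → State d → State d
  | _, [], s => s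
  | O, o :: l, s =>
      removeObstacles V r (O.erase o) l (queueNeighbors V r (restored V r (O.erase o) o) s)

open Classical in
/-- `UpdateObstacles(Onew, Oprev)`: the appeared obstacles are added, then the vanished ones are
removed, each in an arbitrary order. -/
def UpdateObstacles (V : Set (E d)) (r : ℝ) (Onew Oprev : Finset (Set (E d)))
    (s s' : State d) : Prop :=
  ∃ lp lm : List (Set (E d)),
    lp.Nodup ∧ lp.toFinset = Onew \ Oprev ∧ lm.Nodup ∧ lm.toFinset = Oprev \ Onew ∧
    s' = removeObstacles V r (Oprev ∪ Onew) lm (addObstacles V r lp s)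

/-! ### The expansion procedure -/

/-- `z` is an open vertex of least cost. -/
def IsTop (s : State d) (z : E d) : Prop :=
  z ∈ s.opens ∧ ∀ y ∈ s.opens, s.cost z ≤ s.cost y

/-- `y` minimises `c(y) + Cost(y, x)` over the open neighbours of `x`; the vertex `z` that is being
expanded still counts as open. -/
def IsBestParent (V : Set (E d)) (r : ℝ) (z x : E d) (s : State d) (y : E d) : Prop :=
  y ∈ near V r x ∩ insert z s.opens ∧
    ∀ y' ∈ near V r x ∩ insert z s.opens, s.cost y + edist y x ≤ s.cost y' + edist y' x

open Classical in
/-- Connect `x` to the tree through `y`, and make `x` open. -/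
noncomputable def connect (x y : E d) (s : State d) : State d where
  cost := Function.update s.cost x (s.cost y + edist y x)
  parent := Function.update s.parent x (some y)
  opens := insert x s.opens

/-- Body of the inner loop for one vertex `x`: choose a best open parent, and connect `x` to it if
the edge is collision-free; ties are broken arbitrarily. -/
def RelaxVertex (V : Set (E d)) (r : ℝ) (X : Set (E d)) (O : Finset (Set (E d))) (z x : E d)
    (s s' : State d) : Prop :=
  ∃ y, IsBestParent V r z x s y ∧
    ((CollisionFree X O y x ∧ s' = connect x y s) ∨ (¬ CollisionFree X O y x ∧ s' = s))

/-- The inner loop over a list of vertices. -/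
inductive RelaxAll (V : Set (E d)) (r : ℝ) (X : Set (E d)) (O : Finset (Set (E d))) (z : E d) :
    List (E d) → State d → State d → Prop
  | nil (s : State d) : RelaxAll V r X O z [] s s
  | cons {x : E d} {l : List (E d)} {s s' s'' : State d}
      (hx : RelaxVertex V r X O z x s s') (hl : RelaxAll V r X O z l s' s'') :
      RelaxAll V r X O z (x :: l) s s''

/-- Condition of the outer loop, with `z` the top of the open queue. -/
def Guard (robot : E d) (s : State d) (z : E d) : Prop :=
  IsTop s z ∧ (s.cost z < s.cost robot ∨ robot ∈ s.opens)

/-- One pass of the outer loop: extract a top `z`, then treat, in an arbitrary order, all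
neighbours `x` with `c(x) > c(z) + Cost(z, x)`. -/
def Iteration (V : Set (E d)) (r : ℝ) (X : Set (E d)) (O : Finset (Set (E d))) (robot : E d)
    (s s' : State d) : Prop :=
  ∃ z, Guard robot s z ∧ ∃ l : List (E d), l.Nodup ∧
    (∀ x, x ∈ l ↔ x ∈ near V r z ∧ s.cost z + edist z x < s.cost x) ∧
    RelaxAll V r X O z l { s with opens := s.opens \ {z} } s'

/-- A complete execution of the expansion procedure: the loop is run until its condition fails. -/
def Expand (V : Set (E d)) (r : ℝ) (X : Set (E d)) (O : Finset (Set (E d))) (robot : E d)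
    (s s' : State d) : Prop :=
  Relation.ReflTransGen (Iteration V r X O robot) s s' ∧ ¬ ∃ z, Guard robot s' z

/-! ### The whole algorithm -/

/-- A static phase: the obstacles present and the vertex where the robot is. -/
structure Phase (d : ℕ) where
  obstacles : Finset (Set (E d))
  robot : E d

/-- Obstacles of the most recent phase of a history (none before the first phase). -/
def lastObstacles : List (Phase d) → Finset (Set (E d))
  | [] => ∅
  | p :: _ => p.obstacles

/-- `Converged V r X goal h s`: the planner, started on the vertex set `V` and run through the
phases of the history `h` (most recent first), each time updating the obstacles and then expanding
until the loop stops, can end in the state `s`. -/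
inductive Converged (V : Set (E d)) (r : ℝ) (X : Set (E d)) (goal : E d) :
    List (Phase d) → State d → Prop
  | start : Converged V r X goal [] (initState goal)
  | phase {h : List (Phase d)} {p : Phase d} {s s₁ s₂ : State d}
      (hs : Converged V r X goal h s)
      (hu : UpdateObstacles V r p.obstacles (lastObstacles h) s s₁)
      (he : Expand V r X p.obstacles p.robot s₁ s₂) :
      Converged V r X goal (p :: h) s₂

end FMTX

/-!
The theorem splits into a deterministic invariant of the planner and a probabilistic statement
about the samples.

Call a vertex *unobstructed* if all its disk-graph edges are collision-free. Whatever the history,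
every unobstructed vertex `x` satisfies `c(x) ≤ c(z) + ‖z - x‖` for each neighbour `z` that is not
queued (`Converged.consistent`). Appearing obstacles keep this property, because they queue the
neighbours of all vertices that lose their cost. A vertex that becomes unobstructed by the removal
of obstacles gets all its neighbours queued at the removal of the last obstacle blocking one of
its edges. The expansion keeps the property, because at an unobstructed vertex the lazy collision
test cannot fail. When the loop stops, no queued vertex is cheaper than the robot. Hence along a
chain of unobstructed vertices from the goal to the robot either the chain bounds the costs of its
members, or a queued member shows that the robot is cheap already; in both cases the cost at the
robot is at most the length of the chain (`Converged.cost_step`, `Converged.cost_robot_le`).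

The loop terminates because all costs lie in a well-ordered set, namely sums of summands from a
finite set, and every pass lowers the vector of costs or shortens the queue (`exists_expand`).

It remains to find short chains. A nearly optimal path of positive clearance is replaced by an
inscribed polygon with a fixed number of edges (`exists_polygon`); vertices close to it are
unobstructed as soon as the connection radius `r` is small. Each edge is divided into `O(1 / r)`
parts. For large `γ`, with probability tending to one, all balls of radius `r / 4` around the
division points contain samples, which gives a chain with steps at most `r`. Its excess length is
small because all but a small proportion of the much smaller balls of radius `β r` also contain
samples, by Markov's inequality for the number of empty ones; this works for every `β`, so `γ`
need not depend on `ε` (`tendsto_measure_not_hasChain`).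
-/

namespace FMTX

variable {d : ℕ}

/-! ### The invariant and obstacle updates -/

/-- All disk-graph edges at `x` are collision-free. At such a vertex the lazy collision test of the
planner cannot fail, whichever parent it picks. -/
def Unobstructed (V : Set (E d)) (r : ℝ) (X : Set (E d)) (O : Finset (Set (E d))) (x : E d) :
    Prop :=
  ∀ y ∈ near V r x, segment ℝ x y ⊆ freeSpace X O

/-- The cost of `x` cannot be improved through a neighbour, unless this neighbour is queued. -/
def Settled (V : Set (E d)) (r : ℝ) (s : State d) (x : E d) : Prop :=
  ∀ z ∈ near V r x, z ∈ s.opens ∨ s.cost x ≤ s.cost z + edist z x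

/-- The invariant of the planner with obstacles `O`: every unobstructed vertex is settled. The goal
stays the root of the tree, with cost zero. -/
structure Consistent (V : Set (E d)) (r : ℝ) (X : Set (E d)) (O : Finset (Set (E d)))
    (goal : E d) (s : State d) : Prop where
  opens_subset : s.opens ⊆ V
  cost_goal : s.cost goal = 0
  parent_goal : s.parent goal = none
  settled : ∀ x ∈ V, Unobstructed V r X O x → Settled V r s x

theorem mem_near_comm {V : Set (E d)} {r : ℝ} {x z : E d} (hz : z ∈ V) (hx : x ∈ near V r z) :
    z ∈ near V r x :=
  ⟨hz, hx.2.1.symm, by rw [dist_comm]; exact hx.2.2⟩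

theorem goal_notMem_orphans {V : Set (E d)} {o : Set (E d)} {s : State d} {goal : E d}
    (hp : s.parent goal = none) : goal ∉ orphans V o s := by
  rintro ⟨w, -, ⟨y, hy, -⟩, hw⟩
  rcases Relation.ReflTransGen.cases_tail hw with h | ⟨c, -, h⟩
  · subst h; simp [hp] at hy
  · simp [hp] at h

theorem Settled.queueNeighbors {V : Set (E d)} {r : ℝ} {s : State d} {x : E d}
    (h : Settled V r s x) (U : Set (E d)) : Settled V r (queueNeighbors V r U s) x :=
  fun z hz => (h z hz).imp (fun h => Or.inl h) id

theorem settled_queueNeighbors_of_mem {V : Set (E d)} {r : ℝ} {s : State d} {x : E d}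
    {U : Set (E d)} (hx : x ∈ U) : Settled V r (queueNeighbors V r U s) x := by
  intro z hz
  rcases eq_or_ne (s.cost z) ∞ with h | h
  · right; simp [FMTX.queueNeighbors, h]
  · left; exact Or.inr ⟨lt_top_iff_ne_top.2 h, x, hx, hz⟩

/-- A vertex that loses its cost gets its neighbours queued; for any other vertex, the only change
among its neighbours is that some of them lose their cost. -/
theorem Settled.addObstacle {V : Set (E d)} {r : ℝ} {s : State d} {x : E d}
    (h : Settled V r s x) (o : Set (E d)) : Settled V r (addObstacle V r o s) x := by
  by_cases hx : x ∈ orphans V o s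
  · exact settled_queueNeighbors_of_mem hx
  refine Settled.queueNeighbors (fun z hz => ?_) _
  by_cases hzU : z ∈ orphans V o s
  · right; simp [prune, hzU]
  · rcases h z hz with h | h
    · exact Or.inl ⟨h, hzU⟩
    · right; simpa [prune, hx, hzU] using h

theorem Settled.addObstacles {V : Set (E d)} {r : ℝ} {x : E d} (l : List (Set (E d)))
    {s : State d} (h : Settled V r s x) : Settled V r (addObstacles V r l s) x := by
  induction l generalizing s with
  | nil => exact h
  | cons o l ih => exact ih (h.addObstacle o)

theorem addObstacles_root {V : Set (E d)} {r : ℝ} {goal : E d} (l : List (Set (E d)))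
    {s : State d} (ho : s.opens ⊆ V) (hc : s.cost goal = 0) (hp : s.parent goal = none) :
    (addObstacles V r l s).opens ⊆ V ∧ (addObstacles V r l s).cost goal = 0 ∧
      (addObstacles V r l s).parent goal = none := by
  induction l generalizing s with
  | nil => exact ⟨ho, hc, hp⟩
  | cons o l ih =>
    have hg := goal_notMem_orphans (V := V) (o := o) hp
    refine ih (s := addObstacle V r o s) ?_ ?_ ?_
    · rintro y (hy | ⟨-, u, -, hy⟩)
      · exact ho hy.1
      · exact hy.1
    · simpa [addObstacle, FMTX.queueNeighbors, prune, hg] using hc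
    · simpa [addObstacle, FMTX.queueNeighbors, prune, hg] using hp

theorem removeObstacles_root {V : Set (E d)} {r : ℝ} {goal : E d} (l : List (Set (E d)))
    {O : Finset (Set (E d))} {s : State d}
    (ho : s.opens ⊆ V) (hc : s.cost goal = 0) (hp : s.parent goal = none) :
    (removeObstacles V r O l s).opens ⊆ V ∧ (removeObstacles V r O l s).cost goal = 0 ∧
      (removeObstacles V r O l s).parent goal = none := by
  induction l generalizing O s with
  | nil => exact ⟨ho, hc, hp⟩
  | cons o l ih =>
    refine ih ?_ hc hp
    rintro y (hy | ⟨-, u, -, hy⟩)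
    · exact ho hy
    · exact hy.1

theorem Settled.removeObstacles {V : Set (E d)} {r : ℝ} {x : E d} (l : List (Set (E d)))
    {O : Finset (Set (E d))} {s : State d} (h : Settled V r s x) :
    Settled V r (removeObstacles V r O l s) x := by
  induction l generalizing O s with
  | nil => exact h
  | cons o l ih => exact ih (h.queueNeighbors _)

/-- The deletion of the last obstacle that blocks an edge at `x` queues all neighbours of `x`. -/
theorem settled_removeObstacles_of_blocked {V : Set (E d)} {r : ℝ} {x y : E d} (hx : x ∈ V)
    (hy : y ∈ near V r x) (l : List (Set (E d))) {O : Finset (Set (E d))} {s : State d}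
    (hb : ∃ o ∈ O, EdgeBlocked x y o) (hl : ∀ o ∈ O, EdgeBlocked x y o → o ∈ l) :
    Settled V r (removeObstacles V r O l s) x := by
  classical
  induction l generalizing O s with
  | nil => obtain ⟨o, ho, hb⟩ := hb; simpa using hl o ho hb
  | cons o l ih =>
    rw [FMTX.removeObstacles]
    by_cases hb' : ∃ o' ∈ O.erase o, EdgeBlocked x y o'
    · convert ih hb' ?_
      intro o' ho' hb
      rw [Finset.mem_erase] at ho'
      exact (List.mem_cons.1 (hl o' ho'.2 hb)).resolve_left ho'.1
    · obtain ⟨o', ho', hbo⟩ := hb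
      have : o' = o := by
        by_contra hne
        exact hb' ⟨o', Finset.mem_erase.2 ⟨hne, ho'⟩, hbo⟩
      subst this
      refine Settled.removeObstacles l (settled_queueNeighbors_of_mem ⟨hx, y, hy, hbo, ?_⟩)
      intro o'' ho'' hb''
      refine hb' ⟨o'', ?_, hb''⟩
      convert ho''

theorem Consistent.update {V : Set (E d)} {r : ℝ} {X : Set (E d)} {O O' : Finset (Set (E d))}
    {goal : E d} {s s' : State d} (h : Consistent V r X O goal s)
    (hu : UpdateObstacles V r O' O s s') : Consistent V r X O' goal s' := by
  classical
  obtain ⟨lp, lm, -, -, -, hlm, rfl⟩ := hu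
  obtain ⟨h1, h2, h3⟩ := addObstacles_root (r := r) lp h.opens_subset h.cost_goal h.parent_goal
  obtain ⟨k1, k2, k3⟩ := removeObstacles_root (r := r) (O := O ∪ O') lm h1 h2 h3
  refine ⟨by convert k1, by convert k2, by convert k3, fun x hx hfree => ?_⟩
  -- If `x` was not unobstructed before, an obstacle that blocked one of its edges has vanished.
  by_cases hO : Unobstructed V r X O x
  · exact ((h.settled x hx hO).addObstacles lp).removeObstacles lm
  · simp only [Unobstructed, not_forall, Set.not_subset] at hO
    obtain ⟨y, hy, p, hp, hpO⟩ := hO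
    have hpX : p ∈ X := (hfree y hy hp).1
    simp only [freeSpace, Set.mem_sdiff, hpX, true_and, not_not, Set.mem_iUnion] at hpO
    obtain ⟨o, ho, hpo⟩ := hpO
    refine settled_removeObstacles_of_blocked hx hy lm
      ⟨o, Finset.mem_union_left _ ho, p, hp, hpo⟩ ?_
    rintro o₁ ho₁ ⟨q, hq, hqo⟩
    have hn : o₁ ∉ O' := fun hmem =>
      (hfree y hy hq).2 (Set.mem_iUnion₂.2 ⟨o₁, hmem, hqo⟩)
    have hmem : o₁ ∈ lm.toFinset := by
      have : o₁ ∈ O \ O' :=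
        Finset.mem_sdiff.2 ⟨(Finset.mem_union.1 ho₁).resolve_right hn, hn⟩
      convert this
    simpa using hmem

/-! ### The expansion procedure -/

/-- The effect of the inner loop, run on a list `l` of neighbours of the extracted vertex `z` whose
cost can be improved through `z`: a treated vertex only ever gets cheaper, it is open whenever its
cost has changed, and an unobstructed one ends at most at the cost of the connection via `z`. -/
theorem RelaxAll.spec {V : Set (E d)} {r : ℝ} {X : Set (E d)} {O : Finset (Set (E d))} {z : E d}
    {l : List (E d)} {s s' : State d} (h : RelaxAll V r X O z l s s') (hz : z ∈ V)
    (hnd : l.Nodup) (hl : ∀ x ∈ l, x ∈ near V r z ∧ s.cost z + edist z x < s.cost x) :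
    (∀ v, s'.cost v ≤ s.cost v) ∧ (∀ v, s'.cost v ≠ s.cost v → v ∈ s'.opens) ∧
    s.opens ⊆ s'.opens ∧ (∀ v ∈ s'.opens, v ∈ s.opens ∨ v ∈ l) ∧
    (∀ v ∉ l, s'.cost v = s.cost v ∧ s'.parent v = s.parent v) ∧
    (∀ x ∈ l, Unobstructed V r X O x → s'.cost x ≤ s.cost z + edist z x) ∧
    (s' = s ∨ ∃ v ∈ V, s'.cost v < s.cost v) ∧
    (∀ A : Set ℝ≥0∞, (∀ a ∈ A, ∀ u ∈ V, ∀ v ∈ V, a + edist u v ∈ A) →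
      (∀ v ∈ V, s.cost v ∈ A) → ∀ v ∈ V, s'.cost v ∈ A) := by
  induction h with
  | nil s => simp
  | @cons x l s s₁ s₂ hx hr ih =>
    obtain ⟨hxz, hxlt⟩ := hl x (by simp)
    rw [List.nodup_cons] at hnd
    have hzx : z ∈ near V r x := mem_near_comm hz hxz
    obtain ⟨y, ⟨hy, hmin⟩, hcase⟩ := hx
    have hyz := hmin z ⟨hzx, by simp⟩
    have hzl : z ∉ l := fun hmem => (hl z (by simp [hmem])).1.2.1 rfl
    have hzx' : z ≠ x := hzx.2.1
    rcases hcase with ⟨hcf, rfl⟩ | ⟨hcf, rfl⟩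
    · have hc : ∀ v, v ≠ x → (connect x y s).cost v = s.cost v := fun v hv => by
        simp [connect, Function.update_of_ne hv]
      have hcx : (connect x y s).cost x = s.cost y + edist y x := by simp [connect]
      have hcx' : (connect x y s).cost x < s.cost x := by rw [hcx]; exact hyz.trans_lt hxlt
      obtain ⟨i1, i2, i3, i4, i5, i6, i7, i8⟩ := ih hnd.2 (fun w hw => by
        have hwx : w ≠ x := fun h => hnd.1 (h ▸ hw)
        have := hl w (by simp [hw])
        rw [hc z hzx', hc w hwx]; exact this)
      have hle : ∀ v, (connect x y s).cost v ≤ s.cost v := fun v => by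
        rcases eq_or_ne v x with rfl | hv
        · exact hcx'.le
        · exact (hc v hv).le
      refine ⟨fun v => (i1 v).trans (hle v), fun v hv => ?_, fun v hv => i3 (Or.inr hv),
        fun v hv => ?_, fun v hv => ?_, fun w hw hwu => ?_,
        Or.inr ⟨x, hxz.1, (i1 x).trans_lt hcx'⟩, fun A hA hs => i8 A hA fun v hv => ?_⟩
      · rcases eq_or_ne v x with rfl | hvx
        · exact i3 (Or.inl rfl)
        · exact i2 v (by rwa [hc v hvx])
      · rcases i4 v hv with (rfl | h) | h
        · simp
        · exact Or.inl h
        · simp [h]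
      · simp only [List.mem_cons, not_or] at hv
        rw [(i5 v hv.2).1, (i5 v hv.2).2, hc v hv.1]
        simp [connect, Function.update_of_ne hv.1]
      · rcases List.mem_cons.1 hw with rfl | hw
        · exact (i1 w).trans (hcx.le.trans hyz)
        · have := i6 w hw hwu
          rwa [hc z hzx'] at this
      · rcases eq_or_ne v x with rfl | hvx
        · rw [hcx]; exact hA _ (hs y hy.1.1) _ hy.1.1 _ hv
        · rw [hc v hvx]; exact hs v hv
    · obtain ⟨i1, i2, i3, i4, i5, i6, i7, i8⟩ := ih hnd.2 (fun w hw => hl w (by simp [hw]))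
      refine ⟨i1, i2, i3, fun v hv => (i4 v hv).imp id (by simp +contextual),
        fun v hv => i5 v (by simp at hv; exact hv.2), fun w hw hwu => ?_, i7, i8⟩
      rcases List.mem_cons.1 hw with rfl | hw
      · refine absurd ?_ hcf
        rw [CollisionFree, segment_symm]
        exact hwu y hy.1
      · exact i6 w hw hwu

theorem Consistent.iteration {V : Set (E d)} {r : ℝ} {X : Set (E d)} {O : Finset (Set (E d))}
    {goal robot : E d} {s s' : State d} (h : Consistent V r X O goal s)
    (hi : Iteration V r X O robot s s') : Consistent V r X O goal s' := by
  obtain ⟨z, ⟨⟨hzo, -⟩, -⟩, l, hnd, hl, hr⟩ := hi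
  have hz : z ∈ V := h.opens_subset hzo
  obtain ⟨i1, i2, i3, i4, i5, i6, -, -⟩ := hr.spec hz hnd (fun x hx => (hl x).1 hx)
  dsimp only at i1 i2 i3 i4 i5 i6
  have hg : goal ∉ l := fun hmem => by
    have := ((hl goal).1 hmem).2
    simp [h.cost_goal] at this
  have hzl : z ∉ l := fun hmem => ((hl z).1 hmem).1.2.1 rfl
  refine ⟨fun v hv => ?_, (i5 goal hg).1.trans h.cost_goal, (i5 goal hg).2.trans h.parent_goal,
    fun x hx hfree w hw => ?_⟩
  · rcases i4 v hv with h' | h'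
    · exact h.opens_subset h'.1
    · exact ((hl v).1 h').1.1
  by_cases hwo : w ∈ s'.opens
  · exact Or.inl hwo
  right
  have hwc : s'.cost w = s.cost w := by_contra fun hne => hwo (i2 w hne)
  rw [hwc]
  rcases eq_or_ne w z with rfl | hwz
  · by_cases hxl : x ∈ l
    · exact i6 x hxl hfree
    · refine (i1 x).trans (not_lt.1 fun hlt => hxl ((hl x).2 ⟨mem_near_comm hx hw, hlt⟩))
  · rcases h.settled x hx hfree w hw with h' | h'
    · exact absurd (i3 ⟨h', hwz⟩) hwo
    · exact (i1 x).trans h'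

theorem consistent_initState {V : Set (E d)} {r : ℝ} {X : Set (E d)} {goal : E d} (hg : goal ∈ V) :
    Consistent V r X ∅ goal (initState goal) := by
  refine ⟨by simpa [initState] using hg, by simp [initState], rfl, fun x _ _ z _ => ?_⟩
  rcases eq_or_ne z goal with rfl | hz
  · left; simp [initState]
  · right; simp [initState, hz]

theorem Expand.consistent {V : Set (E d)} {r : ℝ} {X : Set (E d)} {O : Finset (Set (E d))}
    {goal robot : E d} {s s' : State d} (he : Expand V r X O robot s s')
    (h : Consistent V r X O goal s) : Consistent V r X O goal s' := by
  obtain ⟨hsteps, -⟩ := he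
  induction hsteps with
  | refl => exact h
  | tail _ hi ih => exact ih.iteration hi

theorem Converged.consistent {V : Set (E d)} {r : ℝ} {X : Set (E d)} {goal : E d} (hg : goal ∈ V)
    {h : List (Phase d)} {s : State d} (hc : Converged V r X goal h s) :
    Consistent V r X (lastObstacles h) goal s := by
  induction hc with
  | start => exact consistent_initState hg
  | phase _ hu he ih => exact he.consistent (ih.update hu)

theorem exists_isTop {V : Set (E d)} (hV : V.Finite) {s : State d} (ho : s.opens ⊆ V)
    (hne : s.opens.Nonempty) : ∃ z, IsTop s z := by
  obtain ⟨z, hz, hmin⟩ := (hV.subset ho).exists_minimalFor s.cost _ hne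
  exact ⟨z, hz, fun y hy => (le_total (s.cost z) (s.cost y)).elim id fun h => hmin hy h⟩

/-- When the loop has stopped, no queued vertex is cheaper than the robot. -/
theorem cost_robot_le_of_mem_opens {V : Set (E d)} (hV : V.Finite) {s : State d}
    (ho : s.opens ⊆ V) {robot v : E d} (hguard : ¬ ∃ z, Guard robot s z) (hv : v ∈ s.opens) :
    s.cost robot ≤ s.cost v := by
  obtain ⟨z, hz⟩ := exists_isTop hV ho ⟨v, hv⟩
  refine le_trans (not_lt.1 fun hlt => hguard ⟨z, hz, Or.inl hlt⟩) (hz.2 v hv)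

/-- The induction step along a chain of vertices. The minimum with the cost of the robot covers the
case that `x` is still queued when the loop stops: then the robot is at most as expensive as `x`. -/
theorem Converged.cost_step {V : Set (E d)} (hV : V.Finite) {r : ℝ} {X : Set (E d)} {goal : E d}
    (hg : goal ∈ V) {p : Phase d} {h : List (Phase d)} {s : State d}
    (hc : Converged V r X goal (p :: h) s) {x y : E d} {D : ℝ≥0∞} (hx : x ∈ V) (hy : y ∈ V)
    (hfree : Unobstructed V r X p.obstacles y) (hxy : dist x y ≤ r)
    (hD : min (s.cost x) (s.cost p.robot) ≤ D) :
    min (s.cost y) (s.cost p.robot) ≤ D + edist x y := by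
  have hcons := hc.consistent hg
  cases hc with
  | phase _ _ he =>
  rcases min_le_iff.1 hD with hD | hD
  · rcases eq_or_ne x y with rfl | hne
    · exact min_le_of_left_le (hD.trans le_self_add)
    rcases hcons.settled y hy hfree x ⟨hx, hne, hxy⟩ with hopen | hle
    · exact min_le_of_right_le <|
        (cost_robot_le_of_mem_opens hV hcons.opens_subset he.2 hopen).trans
          (hD.trans le_self_add)
    · exact min_le_of_left_le (hle.trans (by gcongr))
  · exact min_le_of_right_le (hD.trans le_self_add)

/-! ### Termination -/

theorem exists_relaxAll {V : Set (E d)} (hV : V.Finite) {r : ℝ} {X : Set (E d)}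
    {O : Finset (Set (E d))} {z : E d} (hz : z ∈ V) (l : List (E d)) (hl : ∀ x ∈ l, x ∈ near V r z)
    (s : State d) : ∃ s', RelaxAll V r X O z l s s' := by
  induction l generalizing s with
  | nil => exact ⟨s, .nil s⟩
  | cons x l ih =>
    have hfin : (near V r x ∩ insert z s.opens).Finite := hV.subset fun y hy => hy.1.1
    obtain ⟨y, hy, hmin⟩ := hfin.exists_minimalFor (fun y => s.cost y + edist y x) _
      ⟨z, mem_near_comm hz (hl x (by simp)), by simp⟩
    have hbest : IsBestParent V r z x s y :=
      ⟨hy, fun y' hy' => (le_total _ _).elim id fun h => hmin hy' h⟩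
    have hl' : ∀ x ∈ l, x ∈ near V r z := fun x hx => hl x (by simp [hx])
    by_cases hcf : CollisionFree X O y x
    · obtain ⟨s', hs'⟩ := ih hl' (connect x y s)
      exact ⟨s', .cons ⟨y, hbest, Or.inl ⟨hcf, rfl⟩⟩ hs'⟩
    · obtain ⟨s', hs'⟩ := ih hl' s
      exact ⟨s', .cons ⟨y, hbest, Or.inr ⟨hcf, rfl⟩⟩ hs'⟩

theorem exists_iteration {V : Set (E d)} (hV : V.Finite) {r : ℝ} {X : Set (E d)}
    {O : Finset (Set (E d))} {robot z : E d} {s : State d} (ho : s.opens ⊆ V)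
    (hz : Guard robot s z) : ∃ s', Iteration V r X O robot s s' := by
  have hfin : {x | x ∈ near V r z ∧ s.cost z + edist z x < s.cost x}.Finite :=
    hV.subset fun x hx => hx.1.1
  obtain ⟨s', hs'⟩ := exists_relaxAll hV (r := r) (X := X) (O := O) (ho hz.1.1)
    hfin.toFinset.toList (fun x hx => by simp at hx; exact hx.1) { s with opens := s.opens \ {z} }
  exact ⟨s', z, hz, _, Finset.nodup_toList _, fun x => by simp, hs'⟩

/-- The costs that can occur in an expansion, started with the costs `c`, form a well-ordered set:
they are sums of finitely many summands from a finite set. -/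
theorem exists_wf_costs {V : Set (E d)} (hV : V.Finite) (c : E d → ℝ≥0∞) :
    ∃ A : Set ℝ≥0∞, A.IsPWO ∧ (∀ v ∈ V, c v ∈ A) ∧
      ∀ a ∈ A, ∀ u ∈ V, ∀ v ∈ V, a + edist u v ∈ A := by
  let B : Set NNReal := (fun v => (c v).toNNReal) '' V ∪ Set.image2 nndist V V
  have hB : B.Finite := (hV.image _).union (hV.image2 _ hV)
  have hpwo : (AddSubmonoid.closure B : Set NNReal).IsPWO :=
    Set.IsPWO.addSubmonoid_closure (fun _ _ => zero_le) hB.isPWO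
  refine ⟨insert ∞ ((fun x : NNReal => (x : ℝ≥0∞)) '' (AddSubmonoid.closure B : Set NNReal)),
    (hpwo.image_of_monotone ENNReal.coe_mono).insert _, fun v hv => ?_, ?_⟩
  · rcases eq_or_ne (c v) ∞ with h | h
    · exact Or.inl h
    · exact Or.inr ⟨(c v).toNNReal, AddSubmonoid.subset_closure (Or.inl ⟨v, hv, rfl⟩),
        ENNReal.coe_toNNReal h⟩
  · rintro a (rfl | ⟨a, ha, rfl⟩) u hu v hv
    · simp
    · refine Or.inr ⟨a + nndist u v, add_mem ha (AddSubmonoid.subset_closure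
        (Or.inr ⟨u, hu, v, hv, rfl⟩)), ?_⟩
      rw [edist_nndist]; exact ENNReal.coe_add _ _

theorem exists_expand {V : Set (E d)} (hV : V.Finite) {r : ℝ} {X : Set (E d)}
    {O : Finset (Set (E d))} {goal robot : E d} {s : State d} (hs : Consistent V r X O goal s) :
    ∃ s', Expand V r X O robot s s' := by
  obtain ⟨A, hA, hcA, hadd⟩ := exists_wf_costs hV s.cost
  have : Finite V := hV
  have : WellFoundedLT A := ⟨hA.isWF⟩
  -- Each pass either lowers the vector of costs, or keeps it and shortens the queue.
  obtain ⟨m, hm⟩ : ∃ m : Lex ((V → A) × ℕ),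
      m = toLex (fun v => ⟨s.cost v, hcA v v.2⟩, s.opens.ncard) := ⟨_, rfl⟩
  induction m using WellFoundedLT.induction generalizing s with
  | ind m ih =>
  by_cases hguard : ∃ z, Guard robot s z
  swap
  · exact ⟨s, .refl, hguard⟩
  obtain ⟨z, hz⟩ := hguard
  obtain ⟨s₁, hs₁⟩ := exists_iteration hV (r := r) (X := X) (O := O) hs.opens_subset hz
  have hcons := hs.iteration hs₁
  obtain ⟨z, hz, l, hnd, hl, hr⟩ := id hs₁
  obtain ⟨i1, -, -, -, -, -, i7, i8⟩ :=
    hr.spec (hs.opens_subset hz.1.1) hnd (fun x hx => (hl x).1 hx)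
  have hcA₁ := i8 A hadd hcA
  have hlt : toLex ((fun v : V => (⟨s₁.cost v, hcA₁ v v.2⟩ : A)), s₁.opens.ncard) < m := by
    rw [hm, Prod.Lex.toLex_lt_toLex]
    rcases i7 with rfl | ⟨v, hv, hlt⟩
    · exact Or.inr ⟨rfl, Set.ncard_sdiff_singleton_lt_of_mem hz.1.1 (hV.subset hs.opens_subset)⟩
    · refine Or.inl (lt_of_le_not_ge (fun w => i1 w) fun hge => ?_)
      exact absurd (hge ⟨v, hv⟩) (not_le.2 hlt)
  obtain ⟨s', hs'⟩ := ih _ hlt hcons hcA₁ rfl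
  exact ⟨s', .head hs₁ hs'.1, hs'.2⟩

theorem exists_updateObstacles (V : Set (E d)) (r : ℝ) (O' O : Finset (Set (E d))) (s : State d) :
    ∃ s', UpdateObstacles V r O' O s s' := by
  classical
  exact ⟨_, (O' \ O).toList, (O \ O').toList, Finset.nodup_toList _, by simp,
    Finset.nodup_toList _, by simp, rfl⟩

theorem exists_converged {V : Set (E d)} (hV : V.Finite) (r : ℝ) (X : Set (E d)) {goal : E d}
    (hg : goal ∈ V) (h : List (Phase d)) : ∃ s, Converged V r X goal h s := by
  induction h with
  | nil => exact ⟨_, .start⟩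
  | cons p h ih =>
    obtain ⟨s, hs⟩ := ih
    obtain ⟨s₁, hs₁⟩ := exists_updateObstacles V r p.obstacles (lastObstacles h) s
    obtain ⟨s₂, hs₂⟩ := exists_expand hV (robot := p.robot) ((hs.consistent hg).update hs₁)
    exact ⟨s₂, .phase hs hs₁ hs₂⟩

/-! ### Empty balls -/

/-- The event that none of the first `n` samples lies in `B`. -/
def missEvent {Ω : Type*} (ξ : ℕ → Ω → E d) (n : ℕ) (B : Set (E d)) : Set Ω :=
  {ω | ∀ i < n, ξ i ω ∉ B}

theorem missEvent_eq {Ω : Type*} (ξ : ℕ → Ω → E d) (n : ℕ) (B : Set (E d)) :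
    missEvent ξ n B = ⋂ i ∈ Finset.range n, ξ i ⁻¹' Bᶜ := by
  ext ω; simp [missEvent]

theorem measurableSet_missEvent {Ω : Type*} [MeasurableSpace Ω] {ξ : ℕ → Ω → E d}
    (hξ : ∀ i, Measurable (ξ i)) (n : ℕ) {B : Set (E d)} (hB : MeasurableSet B) :
    MeasurableSet (missEvent ξ n B) := by
  rw [missEvent_eq]
  exact Finset.measurableSet_biInter _ fun i _ => hξ i hB.compl

/-- The ratio of the volumes of the unit ball and of `S`; a ball of radius `ρ` inside `S` is hit by
a sample with probability `ρ ^ d` times this ratio. -/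
noncomputable def unitBallRatio (S : Set (E d)) : ℝ :=
  (volume (Metric.ball (0 : E d) 1) / volume S).toReal

theorem unitBallRatio_pos {S : Set (E d)} (hS0 : volume S ≠ 0) (hStop : volume S ≠ ∞) :
    0 < unitBallRatio S := by
  refine ENNReal.toReal_pos (ENNReal.div_pos ?_ hStop).ne'
    (ENNReal.div_lt_top measure_ball_lt_top.ne hS0).ne
  exact (Metric.measure_ball_pos volume _ one_pos).ne'

theorem measureReal_preimage_ball {S : Set (E d)} (hS : MeasurableSet S)
    {Ω : Type*} [MeasurableSpace Ω] {P : Measure Ω} {X : Ω → E d}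
    (hX : Measurable X) (hunif : pdf.IsUniform X S P volume) {p : E d} {ρ : ℝ} (hρ : 0 < ρ)
    (hb : Metric.ball p ρ ⊆ S) :
    P.real (X ⁻¹' Metric.ball p ρ) = ρ ^ d * unitBallRatio S := by
  have h1 : P (X ⁻¹' Metric.ball p ρ) = (Measure.map X P) (Metric.ball p ρ) :=
    (Measure.map_apply hX Metric.isOpen_ball.measurableSet).symm
  rw [pdf.IsUniform] at hunif
  rw [Measure.real, h1, hunif, cond_apply hS, Set.inter_eq_right.2 hb,
    Measure.addHaar_ball_of_pos volume p hρ, unitBallRatio, finrank_euclideanSpace_fin,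
    mul_left_comm, ENNReal.toReal_mul, ENNReal.toReal_ofReal (by positivity), mul_comm (_⁻¹),
    div_eq_mul_inv]

theorem measure_missEvent_ball_le {S : Set (E d)} (hS : MeasurableSet S)
    {Ω : Type*} [MeasurableSpace Ω] {P : Measure Ω} [IsProbabilityMeasure P] {ξ : ℕ → Ω → E d}
    (hξ : ∀ i, Measurable (ξ i)) (hind : iIndepFun ξ P)
    (hunif : ∀ i, pdf.IsUniform (ξ i) S P volume) {p : E d} {ρ : ℝ} (hρ : 0 < ρ)
    (hb : Metric.ball p ρ ⊆ S) (n : ℕ) :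
    P (missEvent ξ n (Metric.ball p ρ)) ≤
      ENNReal.ofReal (Real.exp (-(n * (ρ ^ d * unitBallRatio S)))) := by
  have hball : MeasurableSet (Metric.ball p ρ) := Metric.isOpen_ball.measurableSet
  rw [missEvent_eq, hind.measure_inter_preimage_eq_mul _ (fun i _ => hball.compl)]
  have h1 : ∀ i ∈ Finset.range n, P (ξ i ⁻¹' (Metric.ball p ρ)ᶜ) ≤
      ENNReal.ofReal (Real.exp (-(ρ ^ d * unitBallRatio S))) := fun i _ => by
    rw [← ofReal_measureReal, Set.preimage_compl, probReal_compl_eq_one_sub (hξ i hball),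
      measureReal_preimage_ball hS (hξ i) (hunif i) hρ hb]
    exact ENNReal.ofReal_le_ofReal (Real.one_sub_le_exp_neg _)
  refine (Finset.prod_le_prod' h1).trans ?_
  rw [Finset.prod_const, Finset.card_range, ← ENNReal.ofReal_pow (Real.exp_nonneg _),
    ← Real.exp_nat_mul, mul_neg]

/-! ### The connection radius -/

theorem radius_pow (hd : 0 < d) {γ : ℝ} {n : ℕ} :
    radius d γ n ^ d = γ ^ d * (Real.log n / n) := by
  rw [radius, mul_pow, one_div, Real.rpow_inv_natCast_pow _ hd.ne']
  exact div_nonneg (Real.log_natCast_nonneg n) n.cast_nonneg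

theorem tendsto_radius (hd : 0 < d) (γ : ℝ) : Tendsto (radius d γ) atTop (𝓝 0) := by
  have h1 : Tendsto (fun n : ℕ => Real.log n / n) atTop (𝓝 0) := by
    have := (Real.isLittleO_log_id_atTop).tendsto_div_nhds_zero
    exact this.comp tendsto_natCast_atTop_atTop
  have hd' : (0 : ℝ) < 1 / d := by positivity
  have h2 := (h1.rpow_const (Or.inr hd'.le)).const_mul γ
  rwa [Real.zero_rpow hd'.ne', mul_zero] at h2

theorem le_radius (hd : 0 < d) {γ : ℝ} (hγ : 1 ≤ γ) {n : ℕ} (hn : 3 ≤ n) :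
    (n : ℝ)⁻¹ ≤ radius d γ n := by
  have hn' : (3 : ℝ) ≤ n := by exact_mod_cast hn
  have hlog : 1 ≤ Real.log n := by
    rw [Real.le_log_iff_exp_le (by linarith)]
    linarith [Real.exp_one_lt_d9]
  have hd1 : (1 : ℝ) ≤ d := by exact_mod_cast hd
  calc (n : ℝ)⁻¹ = (n : ℝ)⁻¹ ^ (1 : ℝ) := (Real.rpow_one _).symm
    _ ≤ (n : ℝ)⁻¹ ^ (1 / (d : ℝ)) := by
      refine Real.rpow_le_rpow_of_exponent_ge (by positivity) (inv_le_one_of_one_le₀ (by linarith))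
        ((div_le_one (by positivity)).2 hd1)
    _ ≤ (Real.log n / n) ^ (1 / (d : ℝ)) := by
      refine Real.rpow_le_rpow (by positivity) ?_ (by positivity)
      rw [inv_eq_one_div]; gcongr
    _ ≤ radius d γ n := le_mul_of_one_le_left
        (Real.rpow_nonneg (div_nonneg (by linarith) (by linarith)) _) hγ

/-- A ball whose radius is the fraction `b` of the connection radius stays empty with a probability
that decays like a power of `n`. -/
theorem measure_missEvent_radius_le (hd : 0 < d) {S : Set (E d)} (hS : MeasurableSet S)
    {Ω : Type*} [MeasurableSpace Ω] {P : Measure Ω} [IsProbabilityMeasure P] {ξ : ℕ → Ω → E d}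
    (hξ : ∀ i, Measurable (ξ i)) (hind : iIndepFun ξ P)
    (hunif : ∀ i, pdf.IsUniform (ξ i) S P volume) {p : E d} {b γ : ℝ} {n : ℕ} (hn : 0 < n)
    (hρ : 0 < b * radius d γ n) (hb : Metric.ball p (b * radius d γ n) ⊆ S) :
    P (missEvent ξ n (Metric.ball p (b * radius d γ n))) ≤
      ENNReal.ofReal ((n : ℝ) ^ (-((b * γ) ^ d * unitBallRatio S))) := by
  refine (measure_missEvent_ball_le hS hξ hind hunif hρ hb n).trans (le_of_eq ?_)
  have hn' : (0 : ℝ) < n := by exact_mod_cast hn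
  rw [Real.rpow_def_of_pos hn', mul_pow, mul_pow, radius_pow hd]
  congr 2
  field_simp

/-- Markov's inequality for the number of events that occur. -/
theorem measure_card_filter_ge_le {Ω ι : Type*} [MeasurableSpace Ω] {P : Measure Ω}
    (T : Finset ι) {A : ι → Set Ω} (hA : ∀ i ∈ T, MeasurableSet (A i)) {q : ℝ≥0∞}
    (hq : ∀ i ∈ T, P (A i) ≤ q) {c : ℝ≥0∞} (hc : c ≠ 0) (hc' : c ≠ ∞) :
    P {ω | c ≤ ∑ i ∈ T, (A i).indicator 1 ω} ≤ T.card * q / c := by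
  refine (meas_ge_le_lintegral_div (Finset.aemeasurable_fun_sum T fun i hi =>
    (measurable_one.indicator (hA i hi)).aemeasurable) hc hc').trans ?_
  gcongr
  rw [lintegral_finsetSum' _ fun i hi => (measurable_one.indicator (hA i hi)).aemeasurable]
  calc ∑ i ∈ T, ∫⁻ ω, (A i).indicator 1 ω ∂P = ∑ i ∈ T, P (A i) :=
        Finset.sum_congr rfl fun i hi => lintegral_indicator_one (hA i hi)
    _ ≤ T.card * q := by
        rw [← nsmul_eq_mul]; exact Finset.sum_le_card_nsmul _ _ _ hq

/-! ### Chains of samples along a segment -/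

/-- There is a chain of points of `Y` with steps of length at most `r` which stays close to the
segment from `a` to `b` and is longer than it by at most `η`. -/
def HasChain (Y : Set (E d)) (r η : ℝ) (a b : E d) : Prop :=
  ∃ (m : ℕ) (x : ℕ → E d),
    (∀ i ≤ m, x i ∈ Y ∧ ∃ p ∈ segment ℝ a b, dist (x i) p ≤ r / 4) ∧
    dist (x 0) a ≤ r / 4 ∧ dist (x m) b ≤ r / 4 ∧
    (∀ i < m, dist (x i) (x (i + 1)) ≤ r) ∧
    ∑ i ∈ Finset.range m, dist (x i) (x (i + 1)) ≤ dist a b + η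

/-- The `i`-th of the points that divide the segment from `a` to `b` into `m` equal parts. -/
noncomputable def divPoint (a b : E d) (m i : ℕ) : E d :=
  AffineMap.lineMap a b ((i : ℝ) / m)

theorem divPoint_mem_segment (a b : E d) {m i : ℕ} (hi : i ≤ m) :
    divPoint a b m i ∈ segment ℝ a b := by
  rw [segment_eq_image_lineMap]
  exact ⟨_, ⟨by positivity, div_le_one_of_le₀ (by exact_mod_cast hi) (by positivity)⟩, rfl⟩

theorem dist_divPoint_succ (a b : E d) (m i : ℕ) :
    dist (divPoint a b m i) (divPoint a b m (i + 1)) = dist a b / m := by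
  rw [divPoint, divPoint, dist_lineMap_lineMap, dist_comm, Real.dist_eq, ← sub_div]
  simp [div_eq_inv_mul]

/-- Each division point is replaced by a nearby point of `Y`. The set `T` collects the indices at
which only the coarse distance `r / 4`, and not `β * r`, is available. -/
theorem hasChain_of_divPoint {Y : Set (E d)} {r η β : ℝ} {a b : E d} {m : ℕ} (hm : 0 < m)
    (hr : 0 ≤ r) (hβ0 : 0 ≤ β) (hβ : β ≤ 1 / 4) (hstep : dist a b / m ≤ r / 2) (T : Finset ℕ)
    (hY : ∀ i ≤ m, ∃ y ∈ Y, dist y (divPoint a b m i) ≤ if i ∈ T then r / 4 else β * r)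
    (hη : 2 * ((m + 1) * (β * r)) + T.card * (r / 2) ≤ η) : HasChain Y r η a b := by
  have hY' : ∀ i, ∃ y, i ≤ m → y ∈ Y ∧
      dist y (divPoint a b m i) ≤ if i ∈ T then r / 4 else β * r := fun i => by
    by_cases hi : i ≤ m
    · obtain ⟨y, hy⟩ := hY i hi
      exact ⟨y, fun _ => hy⟩
    · exact ⟨0, fun h => absurd h hi⟩
  choose x hx using hY'
  have hβr : β * r ≤ r / 4 := by nlinarith
  have hx4 : ∀ i ≤ m, dist (x i) (divPoint a b m i) ≤ r / 4 := fun i hi => by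
    refine (hx i hi).2.trans ?_
    split_ifs <;> linarith
  have hm' : (m : ℝ) ≠ 0 := by positivity
  have hd : ∀ i < m, dist (x i) (x (i + 1)) ≤ dist (x i) (divPoint a b m i) + dist a b / m +
      dist (x (i + 1)) (divPoint a b m (i + 1)) := fun i _ => by
    have := dist_triangle4 (x i) (divPoint a b m i) (divPoint a b m (i + 1)) (x (i + 1))
    rwa [dist_divPoint_succ, dist_comm (divPoint a b m (i + 1))] at this
  refine ⟨m, x, fun i hi => ⟨(hx i hi).1, _, divPoint_mem_segment a b hi, hx4 i hi⟩, ?_, ?_,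
    fun i hi => ?_, ?_⟩
  · simpa [divPoint] using hx4 0 (Nat.zero_le _)
  · simpa [divPoint, hm'] using hx4 m le_rfl
  · linarith [hd i hi, hx4 i hi.le, hx4 (i + 1) hi]
  · set e : ℕ → ℝ := fun i => dist (x i) (divPoint a b m i) with he
    have hsum : ∑ i ∈ Finset.range (m + 1), e i ≤ (m + 1) * (β * r) + T.card * (r / 4) := by
      have h1 : ∀ i ∈ Finset.range (m + 1), e i ≤ β * r + if i ∈ T then r / 4 else 0 := by
        intro i hi
        refine (hx i (Nat.lt_succ_iff.1 (Finset.mem_range.1 hi))).2.trans ?_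
        split_ifs
        · linarith [mul_nonneg hβ0 hr]
        · simp
      refine (Finset.sum_le_sum h1).trans ?_
      rw [Finset.sum_add_distrib, Finset.sum_ite_mem]
      simp only [Finset.sum_const, Finset.card_range, nsmul_eq_mul]
      push_cast
      gcongr
      exact Finset.inter_subset_right
    have h0 : ∀ i, 0 ≤ e i := fun i => dist_nonneg
    calc ∑ i ∈ Finset.range m, dist (x i) (x (i + 1))
        ≤ ∑ i ∈ Finset.range m, (e i + dist a b / m + e (i + 1)) :=
          Finset.sum_le_sum fun i hi => hd i (Finset.mem_range.1 hi)
      _ = dist a b + (∑ i ∈ Finset.range m, e i + ∑ i ∈ Finset.range m, e (i + 1)) := by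
          rw [Finset.sum_add_distrib, Finset.sum_add_distrib]
          simp only [Finset.sum_const, Finset.card_range, nsmul_eq_mul]
          rw [mul_div_cancel₀ _ hm']; ring
      _ ≤ dist a b + (∑ i ∈ Finset.range (m + 1), e i + ∑ i ∈ Finset.range (m + 1), e i) := by
          refine add_le_add le_rfl (add_le_add ?_ ?_)
          · rw [Finset.sum_range_succ]; linarith [h0 m]
          · rw [Finset.sum_range_succ']; linarith [h0 0]
      _ ≤ dist a b + η := by linarith

/-- Chains of samples along a segment that keeps a positive distance from the complement of `S`
exist with probability tending to one. The balls of radius `r / 4` around the `O(1 / r)` division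
points all contain a sample by the union bound, for `γ` large. A small multiple `β * r` of the
radius gives short chains: it suffices that most of the balls of radius `β * r` contain a sample,
and by Markov's inequality this needs only that the probability of a single empty ball tends to
zero, which is true for every `γ`. -/
theorem tendsto_measure_not_hasChain (hd : 0 < d) {S : Set (E d)} (hS : MeasurableSet S)
    (hS0 : volume S ≠ 0) (hStop : volume S ≠ ∞)
    {Ω : Type*} [MeasurableSpace Ω] {P : Measure Ω} [IsProbabilityMeasure P] {ξ : ℕ → Ω → E d}
    (hξ : ∀ i, Measurable (ξ i)) (hind : iIndepFun ξ P)
    (hunif : ∀ i, pdf.IsUniform (ξ i) S P volume) {γ : ℝ} (hγ1 : 1 ≤ γ)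
    (hγ : 2 ≤ (1 / 4 * γ) ^ d * unitBallRatio S) {a b : E d} {δ : ℝ} (hδ : 0 < δ)
    (hab : ∀ p ∈ segment ℝ a b, Metric.ball p δ ⊆ S) {η : ℝ} (hη : 0 < η) :
    Tendsto (fun n : ℕ => P {ω | ¬ HasChain ((fun i => ξ i ω) '' Set.Iio n) (radius d γ n) η a b})
      atTop (𝓝 0) := by
  classical
  set C : ℝ := 2 * dist a b + 3 with hC
  have hC0 : 0 < C := by positivity
  obtain ⟨β, hβ0, hβ4, hβη⟩ : ∃ β : ℝ, 0 < β ∧ β ≤ 1 / 4 ∧ 2 * (C * β) ≤ η / 2 := by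
    refine ⟨min (1 / 4) (η / (4 * C)), by positivity, min_le_left _ _, ?_⟩
    calc 2 * (C * min (1 / 4) (η / (4 * C))) ≤ 2 * (C * (η / (4 * C))) := by
          gcongr; exact min_le_right _ _
      _ = η / 2 := by field_simp; norm_num
  set κ : ℝ := (β * γ) ^ d * unitBallRatio S with hκ
  have hκ0 : 0 < κ := mul_pos (by positivity) (unitBallRatio_pos hS0 hStop)
  -- The two bounds are those for the balls of radius `r / 4` and `β * r`.
  have hlim : Tendsto (fun n : ℕ => ENNReal.ofReal (C * (n : ℝ)⁻¹) +
      ENNReal.ofReal (C / η * (n : ℝ) ^ (-κ))) atTop (𝓝 0) := by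
    have h1 : Tendsto (fun n : ℕ => C * (n : ℝ)⁻¹) atTop (𝓝 0) := by
      simpa using (tendsto_inv_atTop_zero.comp tendsto_natCast_atTop_atTop).const_mul C
    have h2 : Tendsto (fun n : ℕ => C / η * (n : ℝ) ^ (-κ)) atTop (𝓝 0) := by
      simpa using ((tendsto_rpow_neg_atTop hκ0).comp tendsto_natCast_atTop_atTop).const_mul (C / η)
    simpa using (ENNReal.tendsto_ofReal h1).add (ENNReal.tendsto_ofReal h2)
  refine tendsto_of_tendsto_of_tendsto_of_le_of_le' tendsto_const_nhds hlim
    (Eventually.of_forall fun _ => zero_le) ?_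
  filter_upwards [eventually_ge_atTop 3, (tendsto_radius hd γ).eventually_lt_const hδ,
    (tendsto_radius hd γ).eventually_lt_const one_pos] with n hn hrδ hr1
  set r := radius d γ n with hr_def
  have hn0 : (0 : ℝ) < n := by positivity
  have hnr : (n : ℝ)⁻¹ ≤ r := le_radius hd hγ1 hn
  have hr0 : 0 < r := lt_of_lt_of_le (by positivity) hnr
  obtain ⟨m, hm0, hstep, hmr⟩ : ∃ m : ℕ, 0 < m ∧ dist a b / m ≤ r / 2 ∧ (m + 1) * r ≤ C := by
    refine ⟨⌈2 * dist a b / r⌉₊ + 1, by positivity, ?_, ?_⟩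
    · rw [div_le_iff₀ (by positivity)]
      have := Nat.le_ceil (2 * dist a b / r)
      rw [div_le_iff₀ hr0] at this
      push_cast
      nlinarith
    · have := (Nat.ceil_lt_add_one (a := 2 * dist a b / r) (by positivity)).le
      push_cast
      calc ((⌈2 * dist a b / r⌉₊ : ℝ) + 1 + 1) * r ≤ (2 * dist a b / r + 1 + 1 + 1) * r := by
            gcongr
        _ = 2 * dist a b + 3 * r := by field_simp; ring
        _ ≤ C := by rw [hC]; linarith
  have hmn : ((m : ℝ) + 1) ≤ C * n := by
    calc ((m : ℝ) + 1) = (m + 1) * (n : ℝ)⁻¹ * n := by field_simp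
      _ ≤ (m + 1) * r * n := by gcongr
      _ ≤ C * n := by gcongr
  have hmiss : ∀ c : ℝ, 0 < c → c ≤ 1 → ∀ i ∈ Finset.range (m + 1),
      P (missEvent ξ n (Metric.ball (divPoint a b m i) (c * r))) ≤
        ENNReal.ofReal ((n : ℝ) ^ (-((c * γ) ^ d * unitBallRatio S))) := by
    intro c hc hc1 i hi
    refine measure_missEvent_radius_le hd hS hξ hind hunif (by omega) (by positivity) ?_
    refine (Metric.ball_subset_ball ?_).trans (hab _ (divPoint_mem_segment a b
      (Nat.lt_succ_iff.1 (Finset.mem_range.1 hi))))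
    nlinarith
  have hmeas : ∀ c : ℝ, ∀ i ∈ Finset.range (m + 1),
      MeasurableSet (missEvent ξ n (Metric.ball (divPoint a b m i) (c * r))) := fun c i _ =>
    measurableSet_missEvent hξ n Metric.isOpen_ball.measurableSet
  set bad₁ : Set Ω := ⋃ i ∈ Finset.range (m + 1),
    missEvent ξ n (Metric.ball (divPoint a b m i) (1 / 4 * r)) with hbad₁
  set bad₂ : Set Ω := {ω | ENNReal.ofReal (η / r) ≤ ∑ i ∈ Finset.range (m + 1),
    (missEvent ξ n (Metric.ball (divPoint a b m i) (β * r))).indicator 1 ω} with hbad₂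
  have hsub : {ω | ¬ HasChain ((fun i => ξ i ω) '' Set.Iio n) r η a b} ⊆ bad₁ ∪ bad₂ := by
    intro ω hω
    by_contra hgood
    simp only [Set.mem_union, not_or] at hgood
    obtain ⟨hg₁, hg₂⟩ := hgood
    refine hω ?_
    set T : Finset ℕ := (Finset.range (m + 1)).filter fun i =>
      ω ∈ missEvent ξ n (Metric.ball (divPoint a b m i) (β * r)) with hT
    have hTcard : (T.card : ℝ) < η / r := by
      have h1 : ((T.card : ℕ) : ℝ≥0∞) < ENNReal.ofReal (η / r) := by
        refine lt_of_le_of_lt (le_of_eq ?_) (not_le.1 hg₂)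
        simp [hT, Set.indicator_apply, Finset.sum_boole]
      rw [ENNReal.lt_ofReal_iff_toReal_lt (by simp)] at h1
      simpa using h1
    refine hasChain_of_divPoint (β := β) hm0 hr0.le hβ0.le hβ4 hstep T (fun i hi => ?_) ?_
    · have hi' : i ∈ Finset.range (m + 1) := Finset.mem_range.2 (Nat.lt_succ_iff.2 hi)
      split_ifs with hiT
      · have : ω ∉ missEvent ξ n (Metric.ball (divPoint a b m i) (1 / 4 * r)) := fun h =>
          hg₁ (Set.mem_iUnion₂.2 ⟨i, hi', h⟩)
        simp only [missEvent, Set.mem_ofPred_eq, not_forall, not_not] at this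
        obtain ⟨j, hj, hball⟩ := this
        refine ⟨_, ⟨j, hj, rfl⟩, (Metric.mem_ball.1 hball).le.trans (by linarith)⟩
      · have : ω ∉ missEvent ξ n (Metric.ball (divPoint a b m i) (β * r)) := fun h =>
          hiT (Finset.mem_filter.2 ⟨hi', h⟩)
        simp only [missEvent, Set.mem_ofPred_eq, not_forall, not_not] at this
        obtain ⟨j, hj, hball⟩ := this
        exact ⟨_, ⟨j, hj, rfl⟩, (Metric.mem_ball.1 hball).le⟩
    · have h1 : T.card * (r / 2) ≤ η / 2 := by
        rw [lt_div_iff₀ hr0] at hTcard; linarith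
      have h2 : ((m : ℝ) + 1) * (β * r) ≤ C * β := by
        calc ((m : ℝ) + 1) * (β * r) = (m + 1) * r * β := by ring
          _ ≤ C * β := by gcongr
      linarith
  refine (measure_mono hsub).trans ((measure_union_le _ _).trans (add_le_add ?_ ?_))
  · refine (measure_biUnion_finset_le _ _).trans
      ((Finset.sum_le_card_nsmul _ _ _ (hmiss (1 / 4) (by norm_num) (by norm_num))).trans ?_)
    rw [Finset.card_range, nsmul_eq_mul, ← ENNReal.ofReal_natCast,
      ← ENNReal.ofReal_mul (by positivity)]
    refine ENNReal.ofReal_le_ofReal ?_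
    push_cast
    have hn1 : (1 : ℝ) ≤ n := by exact_mod_cast (by omega : 1 ≤ n)
    calc ((m : ℝ) + 1) * (n : ℝ) ^ (-((1 / 4 * γ) ^ d * unitBallRatio S))
        ≤ C * n * (n : ℝ) ^ (-2 : ℝ) := by gcongr
      _ = C * (n : ℝ)⁻¹ := by
        rw [Real.rpow_neg hn0.le, Real.rpow_two]; field_simp
  · refine (measure_card_filter_ge_le _ (hmeas β) (hmiss β hβ0 (by linarith))
      (ENNReal.ofReal_pos.2 (by positivity)).ne' ENNReal.ofReal_ne_top).trans ?_
    rw [Finset.card_range, ← ENNReal.ofReal_natCast, ← ENNReal.ofReal_mul (by positivity),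
      ← ENNReal.ofReal_div_of_pos (by positivity)]
    refine ENNReal.ofReal_le_ofReal ?_
    push_cast
    rw [← hκ]
    calc ((m : ℝ) + 1) * (n : ℝ) ^ (-κ) / (η / r) = ((m + 1) * r) / η * (n : ℝ) ^ (-κ) := by
          field_simp
      _ ≤ C / η * (n : ℝ) ^ (-κ) := by gcongr

/-! ### Polygonal approximation of a path -/

theorem edist_le_pathLength {a b : E d} (σ : Path a b) : edist a b ≤ pathLength σ := by
  have := eVariationOn.edist_le (fun t => σ t) (Set.mem_univ (0 : unitInterval))
    (Set.mem_univ (1 : unitInterval))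
  simpa [pathLength] using this

theorem eq_of_optimalCost_eq_zero {F : Set (E d)} {a b : E d} (h : optimalCost F a b = 0) :
    a = b := by
  rw [← edist_le_zero, ← h]
  exact le_iInf₂ fun σ _ => edist_le_pathLength σ

/-- A path of clearance `δ` yields an inscribed polygon of clearance `δ / 2`, traversed here in the
opposite direction. -/
theorem exists_polygon {F : Set (E d)} {a b : E d} (σ : Path a b) {δ : ℝ} (hδ : 0 < δ)
    (hσ : HasClearance F σ δ) :
    ∃ (K : ℕ) (q : ℕ → E d), 0 < K ∧ q 0 = b ∧ q K = a ∧
      (∀ j < K, ∀ p ∈ segment ℝ (q j) (q (j + 1)), Metric.ball p (δ / 2) ⊆ F) ∧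
      ENNReal.ofReal (∑ j ∈ Finset.range K, dist (q j) (q (j + 1))) ≤ pathLength σ := by
  obtain ⟨η, hη, hunif⟩ := Metric.uniformContinuous_iff.1
    (CompactSpace.uniformContinuous_of_continuous σ.symm.continuous) (δ / 2) (by positivity)
  obtain ⟨K, hK⟩ := exists_nat_one_div_lt hη
  set t : ℕ → unitInterval := fun j => Set.projIcc 0 1 zero_le_one ((j : ℝ) / (K + 1)) with ht
  have hmono : Monotone t := fun i j hij => Set.monotone_projIcc _ (by gcongr)
  have hdist : ∀ j, dist (σ.symm (t (j + 1))) (σ.symm (t j)) < δ / 2 := fun j => by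
    refine hunif (lt_of_le_of_lt ?_ hK)
    refine (LipschitzWith.projIcc (zero_le_one' ℝ)).dist_le_mul _ _ |>.trans ?_
    rw [Real.dist_eq, ← sub_div]
    simp
    rw [abs_of_nonneg (by positivity)]
  refine ⟨K + 1, fun j => σ.symm (t j), K.succ_pos, ?_, ?_, fun j _ p hp => ?_, ?_⟩
  · simp [ht]
  · have : ((K : ℝ) + 1) / (K + 1) = 1 := div_self (by positivity)
    simp [ht, this]
  · have hpj : dist p (σ.symm (t j)) ≤ δ / 2 := by
      have h1 : segment ℝ (σ.symm (t j)) (σ.symm (t (j + 1))) ⊆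
          Metric.closedBall (σ.symm (t j)) (δ / 2) :=
        (convex_closedBall _ _).segment_subset (Metric.mem_closedBall_self (by positivity))
          (hdist j).le
      exact h1 hp
    refine (Metric.ball_subset_ball' (y := σ.symm (t j)) (ε₂ := δ) (by linarith)).trans
      (hσ (unitInterval.symm (t j)))
  · rw [ENNReal.ofReal_sum_of_nonneg fun _ _ => dist_nonneg]
    have h1 := eVariationOn.sum_le (f := fun s => σ.symm s) (n := K + 1) hmono
      (fun i => Set.mem_univ (t i))
    have h2 := eVariationOn.comp_le_of_antitoneOn (fun s => σ s) (s := Set.univ) (t := Set.univ)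
      unitInterval.symm (unitInterval.strictAnti_symm.antitone.antitoneOn _) (Set.mapsTo_univ _ _)
    refine le_trans (le_of_eq ?_) (h1.trans h2)
    refine Finset.sum_congr rfl fun j _ => ?_
    rw [edist_dist, dist_comm]

/-! ### The cost at the robot -/

/-- Far from the boundary of the free space, all disk-graph edges are collision-free. -/
theorem unobstructed_of_dist_le {V X : Set (E d)} {O : Finset (Set (E d))} {r δ : ℝ} {x p : E d}
    (hδ : Metric.ball p δ ⊆ freeSpace X O) (hx : dist x p ≤ r / 4) (hr : r + r / 4 < δ) :
    Unobstructed V r X O x := by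
  intro y hy w hw
  refine hδ ?_
  have h1 : segment ℝ x y ⊆ Metric.closedBall x r :=
    (convex_closedBall _ _).segment_subset
      (Metric.mem_closedBall_self (dist_nonneg.trans hy.2.2)) hy.2.2
  have h2 : dist w x ≤ r := h1 hw
  exact Metric.mem_ball.2 (by linarith [dist_triangle w x p])

theorem finite_vertices {goal : E d} {Q : Set (E d)} (hQ : Q.Finite) (ξ : ℕ → E d) (n : ℕ) :
    (vertices goal Q ξ n).Finite :=
  (hQ.union ((Set.finite_Iio n).image ξ)).insert _

/-- Concatenation of `Converged.cost_step` along the chain over one segment. -/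
theorem Converged.cost_chain {V : Set (E d)} (hV : V.Finite) {r : ℝ} (hr0 : 0 ≤ r) {X : Set (E d)}
    {goal : E d} (hg : goal ∈ V) {p : Phase d} {h : List (Phase d)} {s : State d}
    (hc : Converged V r X goal (p :: h) s) {Y : Set (E d)} (hY : Y ⊆ V) {a b : E d} {η δ : ℝ}
    (hab : ∀ w ∈ segment ℝ a b, Metric.ball w δ ⊆ freeSpace X p.obstacles)
    (hr : r + r / 4 < δ) (hchain : HasChain Y r η a b) {D : ℝ} (hD0 : 0 ≤ D) {x : E d}
    (hx : x ∈ V) (hxa : dist x a ≤ r / 4)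
    (hD : min (s.cost x) (s.cost p.robot) ≤ ENNReal.ofReal D) :
    ∃ y ∈ V, dist y b ≤ r / 4 ∧
      min (s.cost y) (s.cost p.robot) ≤ ENNReal.ofReal (D + (dist a b + η + r)) := by
  obtain ⟨m, u, hu, hu0, hum, hstep, hsum⟩ := hchain
  have hfree : ∀ i ≤ m, Unobstructed V r X p.obstacles (u i) := fun i hi => by
    obtain ⟨-, w, hw, hd⟩ := hu i hi
    exact unobstructed_of_dist_le (hab w hw) hd hr
  have hxu : dist x (u 0) ≤ r := by
    have := dist_triangle_right x (u 0) a
    linarith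
  have key : ∀ i ≤ m, min (s.cost (u i)) (s.cost p.robot) ≤
      ENNReal.ofReal (D + (∑ j ∈ Finset.range i, dist (u j) (u (j + 1)) + r)) := by
    intro i
    induction i with
    | zero =>
      intro hi
      refine (hc.cost_step hV hg hx (hY (hu 0 hi).1) (hfree 0 hi) hxu hD).trans ?_
      rw [edist_dist, ← ENNReal.ofReal_add hD0 dist_nonneg]
      exact ENNReal.ofReal_le_ofReal (by simpa using hxu)
    | succ i ih =>
      intro hi
      refine (hc.cost_step hV hg (hY (hu i (by omega)).1) (hY (hu (i + 1) hi).1) (hfree _ hi)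
        (hstep i (by omega)) (ih (by omega))).trans ?_
      rw [edist_dist, ← ENNReal.ofReal_add (by positivity) dist_nonneg, Finset.sum_range_succ]
      exact ENNReal.ofReal_le_ofReal (by linarith)
  refine ⟨u m, hY (hu m le_rfl).1, hum, (key m le_rfl).trans (ENNReal.ofReal_le_ofReal ?_)⟩
  linarith

/-- The cost at the robot is bounded by the length of a polygon from the goal to the robot, if this
polygon has clearance and there are chains of vertices along its edges. -/
theorem Converged.cost_robot_le {V : Set (E d)} (hV : V.Finite) {r : ℝ} (hr0 : 0 ≤ r)
    {X : Set (E d)} {goal : E d} (hg : goal ∈ V) {p : Phase d} (hp : p.robot ∈ V)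
    {h : List (Phase d)} {s : State d} (hc : Converged V r X goal (p :: h) s) {Y : Set (E d)}
    (hY : Y ⊆ V) {η δ : ℝ} (hr : r + r / 4 < δ) (hη : 0 ≤ η) {K : ℕ} (hK : 0 < K) {q : ℕ → E d}
    (hq0 : q 0 = goal) (hqK : q K = p.robot)
    (hq : ∀ j < K, ∀ w ∈ segment ℝ (q j) (q (j + 1)), Metric.ball w δ ⊆ freeSpace X p.obstacles)
    (hchain : ∀ j < K, HasChain Y r η (q j) (q (j + 1))) :
    s.cost p.robot ≤ ENNReal.ofReal
      (∑ j ∈ Finset.range K, dist (q j) (q (j + 1)) + (K * (η + r) + r)) := by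
  have key : ∀ j ≤ K, ∃ x ∈ V, dist x (q j) ≤ r / 4 ∧ min (s.cost x) (s.cost p.robot) ≤
      ENNReal.ofReal (∑ i ∈ Finset.range j, dist (q i) (q (i + 1)) + j * (η + r)) := by
    intro j
    induction j with
    | zero =>
      intro _
      refine ⟨goal, hg, by rw [hq0, dist_self]; positivity, min_le_of_left_le ?_⟩
      simp [(hc.consistent hg).cost_goal]
    | succ j ih =>
      intro hj
      obtain ⟨x, hx, hxq, hD⟩ := ih (by omega)
      obtain ⟨y, hy, hyq, hD'⟩ := hc.cost_chain hV hr0 hg hY (hq j (by omega)) hr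
        (hchain j (by omega)) (by positivity) hx hxq hD
      refine ⟨y, hy, hyq, hD'.trans (ENNReal.ofReal_le_ofReal ?_)⟩
      rw [Finset.sum_range_succ]
      push_cast
      linarith
  obtain ⟨x, hx, hxq, hD⟩ := key K le_rfl
  rw [hqK] at hxq
  obtain ⟨k, rfl⟩ : ∃ k, K = k + 1 := ⟨K - 1, by omega⟩
  have hfree : Unobstructed V r X p.obstacles p.robot := by
    refine unobstructed_of_dist_le (p := q (k + 1))
      (hq k (by omega) _ (right_mem_segment ℝ _ _)) ?_ hr
    rw [hqK, dist_self]; positivity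
  have := hc.cost_step hV hg hx hp hfree (by linarith) hD
  rw [min_self, edist_dist, ← ENNReal.ofReal_add (by positivity) dist_nonneg] at this
  exact this.trans (ENNReal.ofReal_le_ofReal (by linarith))

theorem tendsto_measure_cost_gt (hd : 0 < d) {S : Set (E d)} (hS : MeasurableSet S)
    (hS0 : volume S ≠ 0) (hStop : volume S ≠ ∞)
    {Ω : Type*} [MeasurableSpace Ω] {P : Measure Ω} [IsProbabilityMeasure P] {ξ : ℕ → Ω → E d}
    (hξ : ∀ i, Measurable (ξ i)) (hind : iIndepFun ξ P)
    (hunif : ∀ i, pdf.IsUniform (ξ i) S P volume) {γ : ℝ} (hγ1 : 1 ≤ γ)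
    (hγ : 2 ≤ (1 / 4 * γ) ^ d * unitBallRatio S)
    {X : Set (E d)} {goal : E d} {Q : Set (E d)} (hQ : Q.Finite) {p : Phase d}
    (hrobot : p.robot ∈ Q) (hfree : freeSpace X p.obstacles ⊆ S)
    (hrobust : RobustlyOptimal (freeSpace X p.obstacles) p.robot goal) {ε : ℝ} (hε : 0 < ε) :
    Tendsto (fun n : ℕ => P {ω | ∃ (h : List (Phase d)) (s : State d),
      Converged (vertices goal Q (fun i => ξ i ω) n) (radius d γ n) X goal (p :: h) s ∧
      ENNReal.ofReal (1 + ε) * optimalCost (freeSpace X p.obstacles) p.robot goal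
        < s.cost p.robot}) atTop (𝓝 0) := by
  set F := freeSpace X p.obstacles with hF
  set c := optimalCost F p.robot goal with hc
  have hgV : ∀ ω n, goal ∈ vertices goal Q (fun i => ξ i ω) n := fun ω n => Or.inl rfl
  have hε1 : 1 < ENNReal.ofReal (1 + ε) := by
    rw [← ENNReal.ofReal_one]; exact (ENNReal.ofReal_lt_ofReal_iff (by linarith)).2 (by linarith)
  rcases eq_or_ne c ∞ with hctop | hctop
  · have : ENNReal.ofReal (1 + ε) * ∞ = ∞ := ENNReal.mul_top (zero_lt_one.trans hε1).ne'
    simp [hctop, this]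
  -- For `c = 0` there is no slack in the factor `1 + ε`, but then the robot is at the goal.
  rcases eq_or_ne c 0 with hc0 | hc0
  · have hrg : p.robot = goal := eq_of_optimalCost_eq_zero hc0
    refine tendsto_const_nhds.congr fun n => ?_
    rw [eq_comm, ← measure_empty (μ := P)]
    congr 1
    refine Set.eq_empty_of_forall_notMem ?_
    rintro ω ⟨h, s, hs, hlt⟩
    rw [hrg, (hs.consistent (hgV ω n)).cost_goal] at hlt
    exact not_lt_zero hlt
  have hlt : c < ENNReal.ofReal (1 + ε) * c := by
    calc c = 1 * c := (one_mul c).symm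
      _ < ENNReal.ofReal (1 + ε) * c := ENNReal.mul_lt_mul_left hc0 hctop hε1
  obtain ⟨σ, ⟨δ, hδ, hσδ⟩, hσ⟩ := hrobust _ hlt
  obtain ⟨K, q, hK, hq0, hqK, hq, hlen⟩ := exists_polygon σ hδ hσδ
  have hbtop : ENNReal.ofReal (1 + ε) * c ≠ ∞ := ENNReal.mul_ne_top ENNReal.ofReal_ne_top hctop
  set ℓ : ℝ := ∑ j ∈ Finset.range K, dist (q j) (q (j + 1)) with hℓ
  set B : ℝ := (ENNReal.ofReal (1 + ε) * c).toReal with hB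
  have hℓB : ℓ < B := by
    have h1 := hlen.trans_lt hσ
    rwa [ENNReal.ofReal_lt_iff_lt_toReal (by positivity) hbtop] at h1
  -- Half of the slack `B - ℓ` is spent on the chains, the other half on the steps between them.
  set η : ℝ := (B - ℓ) / (2 * K) with hη
  have hK' : (0 : ℝ) < K := by exact_mod_cast hK
  have hη0 : 0 < η := div_pos (by linarith) (by positivity)
  have hKη : K * η = (B - ℓ) / 2 := by rw [hη]; field_simp
  have hsum := tendsto_finsetSum (Finset.range K) fun j hj =>
    tendsto_measure_not_hasChain hd hS hS0 hStop hξ hind hunif hγ1 hγ (half_pos hδ)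
      (fun w hw => (hq j (Finset.mem_range.1 hj) w hw).trans hfree) hη0
  rw [Finset.sum_const_zero] at hsum
  refine tendsto_of_tendsto_of_tendsto_of_le_of_le' tendsto_const_nhds hsum
    (Eventually.of_forall fun _ => zero_le) ?_
  filter_upwards [eventually_ge_atTop 3,
    (tendsto_radius hd γ).eventually_lt_const (show 0 < δ / 4 by positivity),
    (tendsto_radius hd γ).eventually_lt_const
      (show 0 < (B - ℓ) / (2 * (K + 1)) from div_pos (by linarith) (by positivity))]
    with n hn hrδ hrB
  have hr0 : 0 ≤ radius d γ n := le_trans (by positivity) (le_radius hd hγ1 hn)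
  refine le_trans (measure_mono ?_) (measure_biUnion_finset_le (Finset.range K)
    fun j => {ω | ¬ HasChain ((fun i => ξ i ω) '' Set.Iio n) (radius d γ n) η (q j) (q (j + 1))})
  rintro ω ⟨h, s, hs, hcost⟩
  by_contra hgood
  simp only [Set.mem_iUnion, Set.mem_ofPred_eq, not_exists, not_not, Finset.mem_range] at hgood
  have hle := hs.cost_robot_le (finite_vertices hQ _ n) hr0 (hgV ω n) (Or.inr (Or.inl hrobot))
    (fun y hy => Or.inr (Or.inr hy)) (by linarith) hη0.le hK hq0 hqK hq hgood
  refine absurd (hcost.trans_le hle) (not_lt.2 ?_)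
  rw [← ENNReal.ofReal_toReal hbtop]
  refine ENNReal.ofReal_le_ofReal ?_
  rw [lt_div_iff₀ (by positivity)] at hrB
  linarith

/-- A connection parameter for which the balls of a quarter of the connection radius are empty
with probability at most `n⁻²`. -/
theorem exists_gamma (hd : 0 < d) {S : Set (E d)} (hS0 : volume S ≠ 0) (hStop : volume S ≠ ∞) :
    ∃ γ₀ : ℝ, 1 ≤ γ₀ ∧ ∀ γ, γ₀ ≤ γ → 2 ≤ (1 / 4 * γ) ^ d * unitBallRatio S := by
  have hκ := unitBallRatio_pos hS0 hStop
  refine ⟨4 * max 1 (2 / unitBallRatio S), by linarith [le_max_left 1 (2 / unitBallRatio S)],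
    fun γ hγ => ?_⟩
  have h1 : max 1 (2 / unitBallRatio S) ≤ 1 / 4 * γ := by linarith
  have h2 : 1 / 4 * γ ≤ (1 / 4 * γ) ^ d := le_self_pow₀ ((le_max_left _ _).trans h1) hd.ne'
  rw [← div_le_iff₀ hκ]
  exact ((le_max_right _ _).trans h1).trans h2

end FMTX

theorem mainTheorem1 (d : ℕ) (hd : 0 < d) (S : Set (FMTX.E d)) (hS : MeasurableSet S)
    (hS0 : volume S ≠ 0) (hStop : volume S ≠ ∞) :
    ∃ γ₀ : ℝ, 0 < γ₀ ∧ ∀ γ : ℝ, γ₀ ≤ γ →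
      ∀ {Ω : Type*} [MeasurableSpace Ω] (P : Measure Ω) [IsProbabilityMeasure P]
        (ξ : ℕ → Ω → FMTX.E d) (_hξ : ∀ i, Measurable (ξ i)) (_hind : iIndepFun ξ P)
        (_hunif : ∀ i, pdf.IsUniform (ξ i) S P volume)
        (X : Set (FMTX.E d)) (goal : FMTX.E d) (Q : Set (FMTX.E d)) (_hQ : Q.Finite)
        (p : FMTX.Phase d) (_hrobot : p.robot ∈ Q)
        (_hfree : FMTX.freeSpace X p.obstacles ⊆ S)
        (_hrobust : FMTX.RobustlyOptimal (FMTX.freeSpace X p.obstacles) p.robot goal),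
        (∀ (n : ℕ) (ω : Ω) (h : List (FMTX.Phase d)),
          (∀ q ∈ h, q.robot ∈ FMTX.vertices goal Q (fun i => ξ i ω) n) →
          ∃ s, FMTX.Converged (FMTX.vertices goal Q (fun i => ξ i ω) n)
            (FMTX.radius d γ n) X goal (p :: h) s) ∧
        ∀ ε : ℝ, 0 < ε →
          Tendsto (fun n : ℕ => P {ω | ∃ (h : List (FMTX.Phase d)) (s : FMTX.State d),
            (∀ q ∈ h, q.robot ∈ FMTX.vertices goal Q (fun i => ξ i ω) n) ∧
            FMTX.Converged (FMTX.vertices goal Q (fun i => ξ i ω) n)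
              (FMTX.radius d γ n) X goal (p :: h) s ∧
            ENNReal.ofReal (1 + ε) *
                FMTX.optimalCost (FMTX.freeSpace X p.obstacles) p.robot goal
              < s.cost p.robot}) atTop (𝓝 0) := by
  obtain ⟨γ₀, hγ₀, hγ⟩ := FMTX.exists_gamma hd hS0 hStop
  refine ⟨γ₀, by linarith, fun γ hle Ω _ P _ ξ hξ hind hunif X goal Q hQ p hrobot hfree hrobust =>
    ⟨fun n ω h _ => FMTX.exists_converged (FMTX.finite_vertices hQ _ n) _ X (Or.inl rfl) _,
      fun ε hε => ?_⟩⟩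
  refine tendsto_of_tendsto_of_tendsto_of_le_of_le tendsto_const_nhds
    (FMTX.tendsto_measure_cost_gt hd hS hS0 hStop hξ hind hunif (hγ₀.trans hle) (hγ γ hle) hQ
      hrobot hfree hrobust hε) (fun _ => zero_le) fun n => measure_mono ?_
  rintro ω ⟨h, s, -, hs⟩
  exact ⟨h, s, hs⟩
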